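/- **Setting.** Let $n\ge 1$, $2<p<\infty$, and let $\Omega\subset\mathbb R^n$ be bounded, non-empty and open. Put $\alpha=\frac{p-2}{p+n}$ and $\beta=\frac{n+2}{p+n}$, so that $\alpha+\beta=1$, and for $\epsilon>0$ let $\Gamma_\epsilon=\{z\in\mathbb R^n\setminus\Omega:\inf_{w\in\partial\Omega}|z-w|\le\epsilon\}$. In the game *tug-of-war with noise* with step length $\epsilon$ and starting point $x_0\in\Omega$, a strategy of a player is a sequence $S=(S_k)_{k\ge 0}$ of Borel measurable functions that assign to each history $h_k=(x_0,(c_1,x_1),\dots,(c_k,x_k))$, with toss results $c_j\in\{0,1,2\}$ and positions $x_j$, a point $S_k(h_k)\in B_\epsilon(x_k)$ of the open ball. Given strategies $S_1,S_2$ of Players 1 and 2, let $\mathbb P^{x_0}_{S_1,S_2}$ be the law of the game sequence $(x_0,(c_1,x_1),(c_2,x_2),\dots)$ whose transitions are as follows. If $x_k\in\Omega$, then with probability $\frac\alpha2$ we have $c_{k+1}=0$ and $x_{k+1}=S_{1,k}(h_k)$; with probability $\frac\alpha2$ we have $c_{k+1}=1$ and $x_{k+1}=S_{2,k}(h_k)$;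 with probability $\beta$ we have $c_{k+1}=2$ and $x_{k+1}$ is uniformly distributed in $B_\epsilon(x_k)$. If $x_k\notin\Omega$, then $x_{k+1}=x_k$. The game ends at the time $\tau=\inf\{k\ge 0: x_k\in\Gamma_\epsilon\}$. A point $y\in\partial\Omega$ is *game regular* if for all $\delta>0$ and $\eta>0$ there exist $\delta_0>0$ and $\epsilon_0>0$ such that for every $0<\epsilon<\epsilon_0$ and every starting point $x_0\in B_{\delta_0}(y)\cap\Omega$ there is a strategy $S_1^*$ of Player 1 such that, for every strategy $S_2$ of Player 2, $$\mathbb P^{x_0}_{S_1^*,S_2}\bigl(\tau<\infty,\ x_\tau\in B_\delta(y)\cap\Omega^c\bigr)\ge 1-\eta .$$ **Lemma.** Let $y\in\partial\Omega$. Suppose that there is a constant $\theta>0$ such that for every $\delta>0$ there exist $\epsilon_0>0$ and $\delta_0>0$ such that for every $0<\epsilon<\epsilon_0$ and every starting point $x_0\in B_{\delta_0}(y)\cap\Omega$ there is a strategy $S_1^*$ of Player 1 such that, for every strategy $S_2$ of Player 2, $$\mathbb P^{x_0}_{S_1^*,S_2}\bigl(\text{the game ends before exiting } B_\delta(y)\bigr)\ge\theta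 ,$$ where the event means that $\tau<\infty$ and $x_k\in B_\delta(y)$ for all $0\le k\le\tau$. Then $y$ is game regular. -/

import Mathlib

open MeasureTheory ProbabilityTheory Metric

/-- The Euclidean space `ℝⁿ`. -/
abbrev Space (n : ℕ) : Type := EuclideanSpace ℝ (Fin n)

/-- One entry `(c_k, x_k)` of a game record: the result `c_k` of the `k`-th toss (`0`: Player 1 wins,
`1`: Player 2 wins, `2`: random movement) and the game position `x_k`. There is no toss before the
starting position: in the entry with index `0` the first component is a fixed dummy value. -/
abbrev Entry (n : ℕ) : Type := Fin 3 × Space n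

/-- A history `h_k = (x_0, (c_1, x_1), …, (c_k, x_k))` of the game up to step `k`. -/
abbrev History (n k : ℕ) : Type := Finset.Iic k → Entry n

/-- A full game sequence `(x_0, (c_1, x_1), (c_2, x_2), …)`. -/
abbrev Play (n : ℕ) : Type := ℕ → Entry n

/-- The last entry `(c_k, x_k)` of a history up to step `k`. -/
def History.last {n k : ℕ} (h : History n k) : Entry n := h ⟨k, Finset.mem_Iic.2 le_rfl⟩

/-- The current game position `x_k` of a history up to step `k`. -/
def History.pos {n k : ℕ} (h : History n k) : Space n := h.last.2

/-- A strategy (of either player) for the game with step length `ε`: for every `k` a Borel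
measurable function of the history `h_k` that gives a next position in the open ball
`B_ε(x_k)`. -/
structure Strategy (n : ℕ) (ε : ℝ) where
  move : (k : ℕ) → History n k → Space n
  measurable_move : ∀ k, Measurable (move k)
  move_mem : ∀ k (h : History n k), move k h ∈ ball h.pos ε

/-- The fixed data of tug-of-war with noise in `ℝⁿ`: an exponent `2 < p < ∞` and a bounded,
non-empty, open game domain. -/
structure TugOfWar (n : ℕ) where
  p : ℝ
  two_lt_p : 2 < p
  domain : Set (Space n)
  isOpen_domain : IsOpen domain
  isBounded_domain : Bornology.IsBounded domain
  nonempty_domain : domain.Nonempty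

theorem History.measurable_last {n k : ℕ} :
    Measurable (History.last : History n k → Entry n) :=
  measurable_pi_apply _

theorem History.measurable_pos {n k : ℕ} :
    Measurable (History.pos : History n k → Space n) :=
  measurable_snd.comp History.measurable_last

theorem Strategy.eps_pos {n : ℕ} {ε : ℝ} (S : Strategy n ε) : 0 < ε :=
  nonempty_ball.1 ⟨_, S.move_mem 0 fun _ => (0, 0)⟩

namespace TugOfWar

variable {n : ℕ} (G : TugOfWar n)

/-- The probability of a tug-of-war round. -/
noncomputable def alpha : ℝ := (G.p - 2) / (G.p + n)

/-- The probability of a noise round. -/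
noncomputable def beta : ℝ := (n + 2) / (G.p + n)

/-- The boundary strip `Γ_ε` of width `ε`. -/
def strip (ε : ℝ) : Set (Space n) := {z | z ∉ G.domain ∧ infDist z (frontier G.domain) ≤ ε}

open Classical in
/-- The transition probability: the law of `(c_{k+1}, x_{k+1})` given the history `h_k`. While the
position is in the domain, Player 1 and Player 2 each move with probability `α / 2`, and with
probability `β` the next position is uniformly distributed in `B_ε(x_k)`. Outside the domain the
position is not moved any more. -/
noncomputable def transition {ε : ℝ} (S₁ S₂ : Strategy n ε) (k : ℕ) (h : History n k) :
    Measure (Entry n) :=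
  if h.pos ∈ G.domain then
    ENNReal.ofReal (G.alpha / 2) • Measure.dirac ((0, S₁.move k h) : Entry n)
      + ENNReal.ofReal (G.alpha / 2) • Measure.dirac ((1, S₂.move k h) : Entry n)
      + ENNReal.ofReal G.beta • (Measure.dirac (2 : Fin 3)).prod (volume[|ball h.pos ε])
  else Measure.dirac h.last

theorem alpha_pos : 0 < G.alpha := by
  have := G.two_lt_p
  unfold alpha
  exact div_pos (by linarith) (by positivity)

theorem beta_pos : 0 < G.beta := by
  have := G.two_lt_p
  unfold beta
  positivity

theorem alpha_add_beta : G.alpha + G.beta = 1 := by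
  have := G.two_lt_p
  have h : G.p + n ≠ 0 := by positivity
  unfold alpha beta
  field_simp
  ring

theorem isProbabilityMeasure_uniform {ε : ℝ} (hε : 0 < ε) (x : Space n) :
    IsProbabilityMeasure (volume[|ball x ε]) :=
  cond_isProbabilityMeasure_of_finite (measure_ball_pos _ _ hε).ne' measure_ball_lt_top.ne

theorem measurable_uniform_apply (ε : ℝ) {t : Set (Space n)} (ht : MeasurableSet t) :
    Measurable fun x : Space n => (volume[|ball x ε]) t := by
  have key : ∀ s : Set (Space n), MeasurableSet s →
      Measurable fun x : Space n => volume (ball x ε ∩ s) := by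
    intro s hs
    have hm : MeasurableSet {q : Space n × Space n | dist q.2 q.1 < ε ∧ q.2 ∈ s} :=
      (measurableSet_lt (measurable_snd.dist measurable_fst) measurable_const).inter
        (measurable_snd hs)
    exact measurable_measure_prodMk_left hm
  simp only [cond_apply measurableSet_ball]
  have h1 := key Set.univ MeasurableSet.univ
  simp only [Set.inter_univ] at h1
  exact h1.inv.mul (key t ht)

theorem isProbabilityMeasure_transition {ε : ℝ} (S₁ S₂ : Strategy n ε) (k : ℕ)
    (h : History n k) : IsProbabilityMeasure (G.transition S₁ S₂ k h) := by
  have := isProbabilityMeasure_uniform S₁.eps_pos h.pos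
  unfold transition
  split_ifs
  · refine ⟨?_⟩
    have ha := G.alpha_pos
    have hb := G.beta_pos
    simp only [Measure.coe_add, Measure.coe_smul, Pi.add_apply, Pi.smul_apply, measure_univ,
      smul_eq_mul, mul_one]
    rw [← ENNReal.ofReal_add (by positivity) (by positivity),
      ← ENNReal.ofReal_add (by positivity) (by positivity), add_halves, G.alpha_add_beta,
      ENNReal.ofReal_one]
  · infer_instance

theorem measurable_transition {ε : ℝ} (S₁ S₂ : Strategy n ε) (k : ℕ) :
    Measurable (G.transition S₁ S₂ k) := by
  unfold transition
  refine Measurable.ite (History.measurable_pos G.isOpen_domain.measurableSet) ?_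
    (Measure.measurable_dirac.comp History.measurable_last)
  refine Measure.measurable_of_measurable_coe _ fun s hs => ?_
  have hd : ∀ (c : Fin 3) (S : Strategy n ε),
      Measurable fun h : History n k => Measure.dirac ((c, S.move k h) : Entry n) s := by
    intro c S
    exact (Measure.measurable_coe hs).comp
      (Measure.measurable_dirac.comp (measurable_const.prodMk (S.measurable_move k)))
  have hu : Measurable fun h : History n k =>
      ((Measure.dirac (2 : Fin 3)).prod (volume[|ball h.pos ε])) s := by
    have h1 : ∀ h : History n k, ((Measure.dirac (2 : Fin 3)).prod (volume[|ball h.pos ε])) s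
        = (volume[|ball h.pos ε]) (Prod.mk 2 ⁻¹' s) := by
      intro h
      rw [Measure.prod_apply hs, lintegral_dirac]
    simp only [h1]
    exact (measurable_uniform_apply ε (measurable_prodMk_left hs)).comp History.measurable_pos
  simp only [Measure.coe_add, Measure.coe_smul, Pi.add_apply, Pi.smul_apply, smul_eq_mul]
  exact (((hd 0 S₁).const_mul _).add ((hd 1 S₂).const_mul _)).add (hu.const_mul _)

/-- The transition probabilities as Markov kernels. -/
noncomputable def kernel {ε : ℝ} (S₁ S₂ : Strategy n ε) (k : ℕ) :
    Kernel (History n k) (Entry n) :=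
  ⟨G.transition S₁ S₂ k, G.measurable_transition S₁ S₂ k⟩

instance {ε : ℝ} (S₁ S₂ : Strategy n ε) (k : ℕ) : IsMarkovKernel (G.kernel S₁ S₂ k) :=
  ⟨G.isProbabilityMeasure_transition S₁ S₂ k⟩

/-- The law `ℙ^{x₀}_{S₁,S₂}` of the game sequence, obtained from the transition probabilities by the
Ionescu-Tulcea (Kolmogorov) extension theorem. -/
noncomputable def law {ε : ℝ} (S₁ S₂ : Strategy n ε) (x₀ : Space n) : Measure (Play n) :=
  Kernel.traj (X := fun _ => Entry n) (G.kernel S₁ S₂) 0 (fun _ => (0, x₀))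

instance {ε : ℝ} (S₁ S₂ : Strategy n ε) (x₀ : Space n) :
    IsProbabilityMeasure (G.law S₁ S₂ x₀) := by
  unfold law
  infer_instance

/-- `τ = k`: the first time at which the position is in the boundary strip is `k`. -/
def EndsAt (ε : ℝ) (ω : Play n) (k : ℕ) : Prop := IsLeast {j | (ω j).2 ∈ G.strip ε} k

/-- The event `x_τ ∈ A`; it includes that the game ends, i.e. `τ < ∞`. -/
def endsIn (ε : ℝ) (A : Set (Space n)) : Set (Play n) :=
  {ω | ∃ k, G.EndsAt ε ω k ∧ (ω k).2 ∈ A}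

/-- The event that the game ends before exiting the set `A`: the game ends, and all positions up to
and including the last one `x_τ` lie in `A`. -/
def endsBeforeExiting (ε : ℝ) (A : Set (Space n)) : Set (Play n) :=
  {ω | ∃ k, G.EndsAt ε ω k ∧ ∀ j ≤ k, (ω j).2 ∈ A}

/-- Game regularity of a boundary point `y`. -/
def GameRegular (y : Space n) : Prop :=
  ∀ δ > 0, ∀ η > 0, ∃ δ₀ > 0, ∃ ε₀ > 0, ∀ ε : ℝ, 0 < ε → ε < ε₀ →
    ∀ x₀ ∈ ball y δ₀ ∩ G.domain, ∃ S₁ : Strategy n ε, ∀ S₂ : Strategy n ε,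
      1 - η ≤ (G.law S₁ S₂ x₀).real (G.endsIn ε (ball y δ ∩ G.domainᶜ))

end TugOfWar

open scoped ENNReal

/-! An attempt in a small ball around `y` succeeds with probability at least `θ`. If it fails by
leaving that ball, the position is still close enough to `y` for another attempt in a larger ball.
After `m` nested attempts the probability of failure is at most `(1 - θ) ^ m`, which tends to `0`.

The hypothesis yields an unrelated strategy for each starting point, and restarting at a random exit
point would require these to depend measurably on it. The proof avoids this by dynamic programming:
strategies are replaced by the finite-horizon values `value ε A k`, for which restarting is the
pointwise inequality `add_mul_value_le`, proved by induction on the number of rounds.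

Two translations frame this argument. `exists_le_value` turns the hypothesis into a lower bound on a
value, by letting Player 2 play almost optimally; a horizon common to all starting points exists
because the noise ends the game uniformly (`exists_forall_law_domain_le`). `exists_strategy_endsIn`
turns a value back into one Borel strategy of Player 1. Both need measurable almost optimal moves.
-/

/-! ### Measurable almost optimal moves -/

theorem exists_measurable_selection {n : ℕ} {ε : ℝ} (w : Space n → ℝ≥0∞)
    (V : Space n → Set ℝ≥0∞) (hV : ∀ x, IsOpen (V x)) (hm : ∀ v, MeasurableSet {x | v ∈ V x})
    (hne : ∀ x, ∃ z ∈ ball x ε, w z ∈ V x) :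
    ∃ s : Space n → Space n, Measurable s ∧ ∀ x, s x ∈ ball x ε ∧ w (s x) ∈ V x := by
  classical
  -- The graph of `w` is separable without any regularity of `w`, and both requirements are open
  -- conditions on a point of the graph. So a countable set of candidates suffices, and the first
  -- admissible one depends measurably on `x`.
  let R : Set (Space n × ℝ≥0∞) := Set.range fun z => (z, w z)
  have : Nonempty R := ⟨⟨_, Set.mem_range_self 0⟩⟩
  obtain ⟨u, hu⟩ := TopologicalSpace.exists_dense_seq R
  choose d hd using fun i => (u i).2
  have hp : ∀ x, ∃ i, d i ∈ ball x ε ∧ w (d i) ∈ V x := by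
    intro x
    have ho : IsOpen {q : R | q.1.1 ∈ ball x ε ∧ q.1.2 ∈ V x} :=
      (isOpen_ball.preimage (continuous_fst.comp continuous_subtype_val)).inter
        ((hV x).preimage (continuous_snd.comp continuous_subtype_val))
    obtain ⟨z, hz, hz'⟩ := hne x
    obtain ⟨i, hi⟩ := hu.exists_mem_open ho ⟨⟨_, Set.mem_range_self z⟩, hz, hz'⟩
    refine ⟨i, ?_⟩
    have h := hd i
    simp only [Set.mem_ofPred_eq, ← h] at hi
    exact hi
  refine ⟨fun x => d (Nat.find (hp x)),
    (measurable_from_nat (f := d)).comp (measurable_find hp fun i => ?_),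
    fun x => Nat.find_spec (hp x)⟩
  have hd' : MeasurableSet {x | d i ∈ ball x ε} := by
    simp only [mem_ball_comm (x := d i)]
    exact measurableSet_ball
  exact hd'.inter (hm _)

/-- Because the balls are open, superlevel sets are unions of open balls, whatever `w` is. -/
theorem measurable_iSup_ball {n : ℕ} (ε : ℝ) (w : Space n → ℝ≥0∞) :
    Measurable fun x : Space n => ⨆ z : ball x ε, w z := by
  refine measurable_of_Ioi fun a => IsOpen.measurableSet ?_
  have : (fun x : Space n => ⨆ z : ball x ε, w z) ⁻¹' Set.Ioi a = ⋃ z ∈ {z | a < w z}, ball z ε := by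
    ext x
    simp only [Set.mem_preimage, Set.mem_Ioi, lt_iSup_iff, Subtype.exists, Set.mem_iUnion,
      Set.mem_ofPred_eq, exists_prop, mem_ball_comm (x := x)]
    exact exists_congr fun z => and_comm
  rw [this]
  exact isOpen_biUnion fun _ _ => isOpen_ball

theorem measurable_iInf_ball {n : ℕ} (ε : ℝ) (w : Space n → ℝ≥0∞) :
    Measurable fun x : Space n => ⨅ z : ball x ε, w z := by
  refine measurable_of_Iio fun a => IsOpen.measurableSet ?_
  have : (fun x : Space n => ⨅ z : ball x ε, w z) ⁻¹' Set.Iio a = ⋃ z ∈ {z | w z < a}, ball z ε := by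
    ext x
    simp only [Set.mem_preimage, Set.mem_Iio, iInf_lt_iff, Subtype.exists, Set.mem_iUnion,
      Set.mem_ofPred_eq, exists_prop, mem_ball_comm (x := x)]
    exact exists_congr fun z => and_comm
  rw [this]
  exact isOpen_biUnion fun _ _ => isOpen_ball

theorem exists_measurable_near_iSup {n : ℕ} {ε : ℝ} (hε : 0 < ε) {w : Space n → ℝ≥0∞}
    (hw : ∀ x, w x ≤ 1) {η : ℝ≥0∞} (hη : η ≠ 0) :
    ∃ s : Space n → Space n, Measurable s ∧
      ∀ x, s x ∈ ball x ε ∧ (⨆ z : ball x ε, w z) ≤ w (s x) + η := by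
  have hne : ∀ x, ∃ z ∈ ball x ε, (⨆ z : ball x ε, w z) < w z + η := by
    intro x
    have : Nonempty (ball x ε) := ⟨⟨x, mem_ball_self hε⟩⟩
    have hlt : (⨆ z : ball x ε, w z) < ⨆ z : ball x ε, (w z + η) := by
      rw [← ENNReal.iSup_add]
      exact ENNReal.lt_add_right
        (ne_top_of_le_ne_top ENNReal.one_ne_top (iSup_le fun z => hw z)) hη
    obtain ⟨z, hz⟩ := lt_iSup_iff.1 hlt
    exact ⟨z, z.2, hz⟩
  obtain ⟨s, hs, hs'⟩ := exists_measurable_selection (ε := ε) w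
    (fun x => {v | (⨆ z : ball x ε, w z) < v + η})
    (fun x => isOpen_lt continuous_const (by fun_prop))
    (fun v => measurableSet_lt (measurable_iSup_ball ε w) measurable_const) hne
  exact ⟨s, hs, fun x => ⟨(hs' x).1, (hs' x).2.le⟩⟩

theorem exists_measurable_near_iInf {n : ℕ} {ε : ℝ} (hε : 0 < ε) {w : Space n → ℝ≥0∞}
    (hw : ∀ x, w x ≤ 1) {η : ℝ≥0∞} (hη : η ≠ 0) :
    ∃ s : Space n → Space n, Measurable s ∧
      ∀ x, s x ∈ ball x ε ∧ w (s x) ≤ (⨅ z : ball x ε, w z) + η := by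
  have hne : ∀ x, ∃ z ∈ ball x ε, w z < (⨅ z : ball x ε, w z) + η := by
    intro x
    have hlt : (⨅ z : ball x ε, w z) < (⨅ z : ball x ε, w z) + η :=
      ENNReal.lt_add_right (ne_top_of_le_ne_top ENNReal.one_ne_top
        ((iInf_le _ ⟨x, mem_ball_self hε⟩).trans (hw x))) hη
    obtain ⟨z, hz⟩ := iInf_lt_iff.1 hlt
    exact ⟨z, z.2, hz⟩
  obtain ⟨s, hs, hs'⟩ := exists_measurable_selection (ε := ε) w
    (fun x => {v | v < (⨅ z : ball x ε, w z) + η})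
    (fun x => isOpen_lt continuous_id continuous_const)
    (fun v => measurableSet_lt measurable_const
      ((measurable_iInf_ball ε w).add measurable_const)) hne
  exact ⟨s, hs, fun x => ⟨(hs' x).1, (hs' x).2.le⟩⟩

theorem uniform_ball_add {n : ℕ} {ε ρ : ℝ} (x v : Space n) (h : ρ + ‖v‖ ≤ ε) :
    (volume[|ball x ε]) (ball (x + v) ρ) =
      (volume (ball (0 : Space n) ε))⁻¹ * volume (ball (0 : Space n) ρ) := by
  have hsub : ball (x + v) ρ ⊆ ball x ε := by
    intro z hz
    rw [mem_ball] at hz ⊢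
    have h1 := dist_triangle z (x + v) x
    rw [dist_eq_norm (x + v) x, add_sub_cancel_left] at h1
    linarith
  rw [cond_apply measurableSet_ball, Set.inter_eq_right.2 hsub, Measure.addHaar_ball_center _ x,
    Measure.addHaar_ball_center _ (x + v)]

/-- The strategy that moves from the position `x` in round `k + 1` to `s k x`. -/
def Strategy.ofPositions {n : ℕ} {ε : ℝ} (s : ℕ → Space n → Space n) (hs : ∀ k, Measurable (s k))
    (hmem : ∀ k x, s k x ∈ ball x ε) : Strategy n ε where
  move k h := s k h.pos
  measurable_move k := (hs k).comp History.measurable_pos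
  move_mem k h := hmem k h.pos

/-- The history up to step `k` of a full game sequence. -/
def Play.history {n : ℕ} (ω : Play n) (k : ℕ) : History n k :=
  Preorder.frestrictLe (π := fun _ => Entry n) k ω

theorem Play.measurable_history {n : ℕ} (k : ℕ) :
    Measurable fun ω : Play n => ω.history k :=
  Preorder.measurable_frestrictLe (X := fun _ => Entry n) k

theorem Play.measurable_history_prodMk {n : ℕ} (k : ℕ) :
    Measurable fun ω : Play n => (ω.history k, ω (k + 1)) :=
  (Play.measurable_history k).prodMk (measurable_pi_apply _)

/-! ### The law of the game, one round at a time -/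

namespace TugOfWar

variable {n : ℕ} (G : TugOfWar n) {ε : ℝ}

/-- The joint law of the history and the next entry is the law of the history composed with the
transition kernel. -/
theorem lintegral_law_succ (S₁ S₂ : Strategy n ε) (x₀ : Space n) (k : ℕ)
    {F : History n k → Entry n → ℝ≥0∞} (hF : Measurable (Function.uncurry F)) :
    ∫⁻ ω : Play n, F (ω.history k) (ω (k + 1)) ∂G.law S₁ S₂ x₀ =
      ∫⁻ ω : Play n, ∫⁻ e, F (ω.history k) e
        ∂G.transition S₁ S₂ k (ω.history k) ∂G.law S₁ S₂ x₀ := by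
  have h := Kernel.partialTraj_compProd_eq_map_traj (X := fun _ => Entry n)
    (κ := G.kernel S₁ S₂) (Nat.zero_le k) (x₀ := fun _ => (0, x₀))
  have h2 := Kernel.traj_map_frestrictLe_apply (X := fun _ => Entry n) (κ := G.kernel S₁ S₂)
    (a := 0) k (fun _ => (0, x₀))
  have hm : Measurable fun h : History n k => ∫⁻ e, F h e ∂G.kernel S₁ S₂ k h :=
    hF.lintegral_kernel_prod_right'
  calc _ = ∫⁻ q, Function.uncurry F q ∂(G.law S₁ S₂ x₀).map
            (fun ω : Play n => (ω.history k, ω (k + 1))) := by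
        rw [lintegral_map hF (Play.measurable_history_prodMk k)]
        rfl
    _ = ∫⁻ h, ∫⁻ e, F h e ∂G.kernel S₁ S₂ k h
          ∂(G.law S₁ S₂ x₀).map (fun ω : Play n => ω.history k) := by
        have h' : (G.law S₁ S₂ x₀).map (fun ω : Play n => (ω.history k, ω (k + 1))) = _ := h.symm
        have h2' : (G.law S₁ S₂ x₀).map (fun ω : Play n => ω.history k) = _ := h2
        rw [h', h2', Measure.lintegral_compProd hF]
        rfl
    _ = _ := by
        rw [lintegral_map hm (Play.measurable_history k)]
        rfl

theorem ae_law_zero (S₁ S₂ : Strategy n ε) (x₀ : Space n) :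
    ∀ᵐ ω ∂G.law S₁ S₂ x₀, ω 0 = (0, x₀) := by
  have h2 := Kernel.traj_map_frestrictLe_apply (X := fun _ => Entry n) (κ := G.kernel S₁ S₂)
    (a := 0) 0 (fun _ => (0, x₀))
  rw [Kernel.partialTraj_self, Kernel.id_apply] at h2
  have h3 : ∀ᵐ h ∂(G.law S₁ S₂ x₀).map (Preorder.frestrictLe 0 : Play n → History n 0),
      History.last h = (0, x₀) := by
    unfold law
    rw [h2, ae_dirac_iff (measurableSet_eq_fun History.measurable_last measurable_const)]
    rfl
  exact ae_of_ae_map (by fun_prop) h3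

theorem lintegral_transition_of_mem (S₁ S₂ : Strategy n ε) {k : ℕ} {h : History n k}
    (hh : h.pos ∈ G.domain) {f : Entry n → ℝ≥0∞} (hf : Measurable f) :
    ∫⁻ e, f e ∂G.transition S₁ S₂ k h =
      ENNReal.ofReal (G.alpha / 2) * f (0, S₁.move k h)
        + ENNReal.ofReal (G.alpha / 2) * f (1, S₂.move k h)
        + ENNReal.ofReal G.beta * ∫⁻ z, f (2, z) ∂volume[|ball h.pos ε] := by
  rw [transition, if_pos hh, lintegral_add_measure, lintegral_add_measure, lintegral_smul_measure,
    lintegral_smul_measure, lintegral_smul_measure, lintegral_dirac' _ hf, lintegral_dirac' _ hf,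
    lintegral_prod _ hf.aemeasurable, lintegral_dirac]
  rfl

theorem lintegral_transition_of_notMem (S₁ S₂ : Strategy n ε) {k : ℕ} {h : History n k}
    (hh : h.pos ∉ G.domain) {f : Entry n → ℝ≥0∞} (hf : Measurable f) :
    ∫⁻ e, f e ∂G.transition S₁ S₂ k h = f h.last := by
  rw [transition, if_neg hh, lintegral_dirac' _ hf]

theorem ae_law_notMem_of_transition_eq_zero (S₁ S₂ : Strategy n ε) (x₀ : Space n) (k : ℕ)
    {B : Set (History n k × Entry n)} (hB : MeasurableSet B)
    (h0 : ∀ h, G.transition S₁ S₂ k h (Prod.mk h ⁻¹' B) = 0) :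
    ∀ᵐ ω ∂G.law S₁ S₂ x₀, (ω.history k, ω (k + 1)) ∉ B := by
  have h := G.lintegral_law_succ S₁ S₂ x₀ k (F := fun a b => B.indicator 1 (a, b))
    (measurable_one.indicator hB)
  have h1 : ∀ a, ∫⁻ b, B.indicator (1 : History n k × Entry n → ℝ≥0∞) (a, b) ∂G.transition S₁ S₂ k a = 0 := by
    intro a
    rw [← h0 a, ← lintegral_indicator_one (measurable_prodMk_left hB)]
    rfl
  simp only [h1, lintegral_zero] at h
  have hm : Measurable fun ω : Play n =>
      B.indicator (1 : History n k × Entry n → ℝ≥0∞) (ω.history k, ω (k + 1)) :=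
    (measurable_one.indicator hB).comp (Play.measurable_history_prodMk k)
  rw [lintegral_eq_zero_iff hm] at h
  filter_upwards [h] with ω hω hc
  simp [Set.indicator_of_mem hc] at hω

theorem transition_eq_zero (S₁ S₂ : Strategy n ε) {k : ℕ} (h : History n k) {B : Set (Entry n)}
    (hB : MeasurableSet B) (hin : h.pos ∈ G.domain → ∀ e, e.2 ∈ ball h.pos ε → e ∉ B)
    (hout : h.pos ∉ G.domain → h.last ∉ B) : G.transition S₁ S₂ k h B = 0 := by
  rw [← lintegral_indicator_one hB]
  by_cases hh : h.pos ∈ G.domain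
  · rw [G.lintegral_transition_of_mem S₁ S₂ hh (measurable_one.indicator hB),
      Set.indicator_of_notMem (hin hh (0, S₁.move k h) (S₁.move_mem k h)),
      Set.indicator_of_notMem (hin hh (1, S₂.move k h) (S₂.move_mem k h))]
    have h3 : ∫⁻ z, B.indicator (1 : Entry n → ℝ≥0∞) (2, z) ∂volume[|ball h.pos ε] = 0 := by
      rw [← lintegral_zero (μ := volume[|ball h.pos ε])]
      refine lintegral_congr_ae ?_
      filter_upwards [ae_cond_mem measurableSet_ball] with z hz
      exact Set.indicator_of_notMem (hin hh (2, z) hz) _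
    rw [h3]
    simp
  · rw [G.lintegral_transition_of_notMem S₁ S₂ hh (measurable_one.indicator hB),
      Set.indicator_of_notMem (hout hh)]

theorem ae_law_succ (S₁ S₂ : Strategy n ε) (x₀ : Space n) :
    ∀ᵐ ω ∂G.law S₁ S₂ x₀, ∀ k, dist (ω (k + 1)).2 (ω k).2 < ε ∧
      ((ω k).2 ∈ G.domain ∨ (ω (k + 1)).2 = (ω k).2) := by
  rw [ae_all_iff]
  intro k
  have hm : MeasurableSet {q : History n k × Entry n |
      ¬ (dist q.2.2 q.1.pos < ε ∧ (q.1.pos ∈ G.domain ∨ q.2.2 = q.1.pos))} := by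
    have h1 : Measurable fun q : History n k × Entry n => q.1.pos :=
      History.measurable_pos.comp measurable_fst
    have h2 : Measurable fun q : History n k × Entry n => q.2.2 :=
      measurable_snd.comp measurable_snd
    exact ((measurableSet_lt (h2.dist h1) measurable_const).inter
      ((h1 G.isOpen_domain.measurableSet).union (measurableSet_eq_fun h2 h1))).compl
  filter_upwards [G.ae_law_notMem_of_transition_eq_zero S₁ S₂ x₀ k hm fun h =>
    G.transition_eq_zero S₁ S₂ h (measurable_prodMk_left hm)
      (fun hh e he hc => hc ⟨he, Or.inl hh⟩)
      (fun hh hc => hc ⟨by simpa [History.pos] using S₁.eps_pos, Or.inr rfl⟩)] with ω hω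
  exact not_not.1 hω

/-! ### Finite-horizon values and the restart inequality -/

/-- The expected value of `w` after one round from a position in the domain, when Player 1
maximizes and Player 2 minimizes it. -/
noncomputable def roundValue (ε : ℝ) (w : Space n → ℝ≥0∞) (x : Space n) : ℝ≥0∞ :=
  ENNReal.ofReal (G.alpha / 2) * (⨆ z : ball x ε, w z)
    + ENNReal.ofReal (G.alpha / 2) * (⨅ z : ball x ε, w z)
    + ENNReal.ofReal G.beta * ∫⁻ z, w z ∂volume[|ball x ε]

open Classical in
/-- The value for Player 1 of the game that is won if within `k` rounds a position outside the
domain is reached before exiting `A`. -/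
noncomputable def value (ε : ℝ) (A : Set (Space n)) : ℕ → Space n → ℝ≥0∞
  | 0, x => if x ∈ A ∧ x ∉ G.domain then 1 else 0
  | k + 1, x =>
    if x ∈ A then if x ∈ G.domain then G.roundValue ε (value ε A k) x else 1 else 0

theorem value_of_notMem {A : Set (Space n)} {x : Space n} (hx : x ∉ A) (k : ℕ) :
    G.value ε A k x = 0 := by
  cases k <;> simp [value, hx]

theorem value_of_notMem_domain {A : Set (Space n)} {x : Space n} (hx : x ∈ A)
    (hx' : x ∉ G.domain) (k : ℕ) : G.value ε A k x = 1 := by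
  cases k <;> simp [value, hx, hx']

theorem value_succ {A : Set (Space n)} {x : Space n} (hx : x ∈ A) (hx' : x ∈ G.domain) (k : ℕ) :
    G.value ε A (k + 1) x = G.roundValue ε (G.value ε A k) x := by
  simp [value, hx, hx']

theorem sum_weights : ENNReal.ofReal (G.alpha / 2) + ENNReal.ofReal (G.alpha / 2)
    + ENNReal.ofReal G.beta = 1 := by
  have ha := G.alpha_pos
  have hb := G.beta_pos
  rw [← ENNReal.ofReal_add (by positivity) (by positivity),
    ← ENNReal.ofReal_add (by positivity) (by positivity), add_halves, G.alpha_add_beta,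
    ENNReal.ofReal_one]

theorem weight_le_one : ENNReal.ofReal (G.alpha / 2) ≤ 1 := by
  rw [← G.sum_weights, add_assoc]
  exact le_self_add

theorem roundValue_mono {w v : Space n → ℝ≥0∞} {x : Space n} (h : ∀ z ∈ ball x ε, w z ≤ v z) :
    G.roundValue ε w x ≤ G.roundValue ε v x := by
  unfold roundValue
  refine add_le_add (add_le_add ?_ ?_) ?_
  · exact mul_le_mul_right (iSup_mono fun z : ball x ε => h z z.2) _
  · exact mul_le_mul_right (iInf_mono fun z : ball x ε => h z z.2) _
  · refine mul_le_mul_right (lintegral_mono_ae ?_) _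
    filter_upwards [ae_cond_mem measurableSet_ball] with z hz using h z hz

/-- The three weights add up to `1`, so an affine change of the payoff passes through a round. This
carries the induction step of `add_mul_value_le`. -/
theorem add_mul_roundValue_le (hε : 0 < ε) {w : Space n → ℝ≥0∞} (hw : Measurable w)
    (c d : ℝ≥0∞) (x : Space n) :
    c + d * G.roundValue ε w x ≤ G.roundValue ε (fun z => c + d * w z) x := by
  have : Nonempty (ball x ε) := ⟨⟨x, mem_ball_self hε⟩⟩
  have := isProbabilityMeasure_uniform hε x
  have h1 : (⨆ z : ball x ε, (c + d * w z)) = c + d * ⨆ z : ball x ε, w z := by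
    rw [ENNReal.mul_iSup, ENNReal.add_iSup]
  have h2 : c + d * (⨅ z : ball x ε, w z) ≤ ⨅ z : ball x ε, (c + d * w z) :=
    le_iInf fun z => add_le_add_right (mul_le_mul_right (iInf_le _ z) _) _
  have h3 : ∫⁻ z, (c + d * w z) ∂volume[|ball x ε] = c + d * ∫⁻ z, w z ∂volume[|ball x ε] := by
    rw [lintegral_add_left measurable_const, lintegral_const_mul _ hw]
    simp
  unfold roundValue
  rw [h1, h3]
  calc _ = (ENNReal.ofReal (G.alpha / 2) + ENNReal.ofReal (G.alpha / 2)
        + ENNReal.ofReal G.beta) * c + d * (ENNReal.ofReal (G.alpha / 2) * (⨆ z : ball x ε, w z)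
    + ENNReal.ofReal (G.alpha / 2) * (⨅ z : ball x ε, w z)
    + ENNReal.ofReal G.beta * ∫⁻ z, w z ∂volume[|ball x ε]) := by rw [G.sum_weights, one_mul]
    _ = ENNReal.ofReal (G.alpha / 2) * (c + d * ⨆ z : ball x ε, w z)
      + ENNReal.ofReal (G.alpha / 2) * (c + d * ⨅ z : ball x ε, w z)
      + ENNReal.ofReal G.beta * (c + d * ∫⁻ z, w z ∂volume[|ball x ε]) := by ring
    _ ≤ _ := by gcongr

theorem roundValue_le_one {w : Space n → ℝ≥0∞} (hε : 0 < ε) (hw : ∀ x, w x ≤ 1) (x : Space n) :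
    G.roundValue ε w x ≤ 1 := by
  have := isProbabilityMeasure_uniform hε x
  have h3 : ∫⁻ z, w z ∂volume[|ball x ε] ≤ 1 := by
    calc _ ≤ ∫⁻ z, 1 ∂volume[|ball x ε] := lintegral_mono hw
      _ = 1 := by simp
  have h2 : (⨅ z : ball x ε, w z) ≤ 1 := (iInf_le _ ⟨x, mem_ball_self hε⟩).trans (hw _)
  have h1 : (⨆ z : ball x ε, w z) ≤ 1 := iSup_le fun z => hw z
  rw [← G.sum_weights]
  unfold roundValue
  refine add_le_add (add_le_add ?_ ?_) ?_ <;> exact mul_le_of_le_one_right' (by assumption)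

theorem value_le_one (hε : 0 < ε) (A : Set (Space n)) (k : ℕ) (x : Space n) :
    G.value ε A k x ≤ 1 := by
  induction k generalizing x with
  | zero => unfold value; split_ifs <;> simp
  | succ k ih =>
    unfold value
    split_ifs
    · exact G.roundValue_le_one hε ih x
    all_goals simp

theorem measurable_lintegral_uniform {w : Space n → ℝ≥0∞} (hw : Measurable w) :
    Measurable fun x : Space n => ∫⁻ z, w z ∂volume[|ball x ε] :=
  (Measure.measurable_lintegral hw).comp
    (Measure.measurable_of_measurable_coe _ fun _ ht => measurable_uniform_apply ε ht)

theorem measurable_value {A : Set (Space n)} (hA : MeasurableSet A) (k : ℕ) :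
    Measurable (G.value ε A k) := by
  classical
  have hD := G.isOpen_domain.measurableSet
  induction k with
  | zero => exact Measurable.ite (hA.inter hD.compl) measurable_const measurable_const
  | succ k ih =>
    refine Measurable.ite hA (Measurable.ite hD ?_ measurable_const) measurable_const
    exact (((measurable_iSup_ball ε _).const_mul _).add
      ((measurable_iInf_ball ε _).const_mul _)).add
      ((measurable_lintegral_uniform ih).const_mul _)

theorem value_le_value_succ (A : Set (Space n)) (k : ℕ) (x : Space n) :
    G.value ε A k x ≤ G.value ε A (k + 1) x := by
  by_cases hA : x ∈ A
  · by_cases hD : x ∈ G.domain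
    · induction k generalizing x with
      | zero => simp [value, hD]
      | succ k ih =>
        rw [G.value_succ hA hD, G.value_succ hA hD]
        refine G.roundValue_mono fun z _ => ?_
        by_cases hA : z ∈ A
        · by_cases hD : z ∈ G.domain
          · exact ih z hA hD
          · rw [G.value_of_notMem_domain hA hD, G.value_of_notMem_domain hA hD]
        · rw [G.value_of_notMem hA, G.value_of_notMem hA]
    · rw [G.value_of_notMem_domain hA hD, G.value_of_notMem_domain hA hD]
  · rw [G.value_of_notMem hA, G.value_of_notMem hA]

theorem monotone_value (A : Set (Space n)) : Monotone (G.value ε A) :=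
  monotone_nat_of_le_succ fun k x => G.value_le_value_succ A k x

/-- Winning from every point of `ball y (r + ε)` with value `c`, Player 1 can first try to win
before exiting `ball y r` and start anew upon exiting it. -/
theorem add_mul_value_le (hε : 0 < ε) (y : Space n) {r R : ℝ} (hr : r + ε ≤ R) {c : ℝ≥0∞}
    (hc : c ≤ 1) {M : ℕ} (h : ∀ x ∈ ball y (r + ε) ∩ G.domain, c ≤ G.value ε (ball y R) M x)
    (N : ℕ) {x : Space n} (hx : x ∈ ball y (r + ε)) :
    c + (1 - c) * G.value ε (ball y r) N x ≤ G.value ε (ball y R) (M + N) x := by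
  have hsub : ball y (r + ε) ⊆ ball y R := ball_subset_ball hr
  have h1 : ∀ k, ∀ x ∉ G.domain,
      c + (1 - c) * G.value ε (ball y r) k x ≤ 1 := fun k x _ => by
    calc _ ≤ c + (1 - c) * 1 := by gcongr; exact G.value_le_one hε _ _ _
      _ = 1 := by rw [mul_one, add_tsub_cancel_of_le hc]
  induction N generalizing x with
  | zero =>
    by_cases hD : x ∈ G.domain
    · simpa [value, hD] using h x ⟨hx, hD⟩
    · rw [G.value_of_notMem_domain (hsub hx) hD]
      exact h1 0 x hD
  | succ N ih =>
    by_cases hD : x ∈ G.domain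
    · by_cases hxr : x ∈ ball y r
      · rw [G.value_succ hxr hD, ← add_assoc, G.value_succ (hsub hx) hD]
        refine (G.add_mul_roundValue_le hε
          (G.measurable_value measurableSet_ball N) c (1 - c) x).trans
          (G.roundValue_mono fun z hz => ih ?_)
        -- A move from `ball y r` is shorter than `ε`, so it cannot jump over the shell where the
        -- restart is available.
        rw [mem_ball] at hz hxr ⊢
        linarith [dist_triangle z x y]
      -- In the shell the first attempt has failed, and the `M` rounds kept in reserve are worth at
      -- least `c`.
      · rw [G.value_of_notMem hxr, mul_zero, add_zero]
        exact (h x ⟨hx, hD⟩).trans (G.monotone_value _ (Nat.le_add_right _ _) x)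
    · rw [G.value_of_notMem_domain (hsub hx) hD]
      exact h1 _ x hD

/-! ### Almost optimal play realizes the values -/

/-- Up to `η` per round, the value of the remaining game is a submartingale, whatever Player 2 does.
-/
theorem le_lintegral_transition_of_near_iSup {A : Set (Space n)} (hA : MeasurableSet A)
    (S₁ S₂ : Strategy n ε) {k : ℕ} (h : History n k) (m : ℕ) {η : ℝ≥0∞}
    (hS : (⨆ z : ball h.pos ε, G.value ε A m z) ≤ G.value ε A m (S₁.move k h) + η) :
    G.value ε A (m + 1) h.pos ≤ ∫⁻ e, G.value ε A m e.2 ∂G.transition S₁ S₂ k h + η := by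
  have hf : Measurable fun e : Entry n => G.value ε A m e.2 :=
    (G.measurable_value hA m).comp measurable_snd
  by_cases hD : h.pos ∈ G.domain
  · by_cases hA : h.pos ∈ A
    · rw [G.value_succ hA hD, G.lintegral_transition_of_mem S₁ S₂ hD hf, roundValue]
      have h2 : (⨅ z : ball h.pos ε, G.value ε A m z) ≤ G.value ε A m (S₂.move k h) :=
        iInf_le _ (⟨_, S₂.move_mem k h⟩ : ball h.pos ε)
      have h1 : ENNReal.ofReal (G.alpha / 2) * (⨆ z : ball h.pos ε, G.value ε A m z) ≤
          ENNReal.ofReal (G.alpha / 2) * G.value ε A m (S₁.move k h) + η := by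
        refine (mul_le_mul_right hS _).trans ?_
        rw [mul_add]
        gcongr
        exact mul_le_of_le_one_left' G.weight_le_one
      rw [add_right_comm _ _ η, add_right_comm _ _ η]
      gcongr
    · rw [G.value_of_notMem hA]
      exact zero_le
  · rw [G.lintegral_transition_of_notMem S₁ S₂ hD hf]
    refine le_add_right (le_of_eq ?_)
    change _ = G.value ε A m h.pos
    by_cases hA : h.pos ∈ A
    · rw [G.value_of_notMem_domain hA hD, G.value_of_notMem_domain hA hD]
    · rw [G.value_of_notMem hA, G.value_of_notMem hA]

/-- The supermartingale counterpart. It is confined to positions in `A`: outside, the value is `0`,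
but the play may return to `A`. -/
theorem lintegral_transition_le_of_near_iInf {A : Set (Space n)} (hA : MeasurableSet A)
    (S₁ S₂ : Strategy n ε) {k : ℕ} (h : History n k) (hh : h.pos ∈ A) (m : ℕ) {η : ℝ≥0∞}
    (hS : G.value ε A m (S₂.move k h) ≤ (⨅ z : ball h.pos ε, G.value ε A m z) + η) :
    ∫⁻ e, G.value ε A m e.2 ∂G.transition S₁ S₂ k h ≤ G.value ε A (m + 1) h.pos + η := by
  have hf : Measurable fun e : Entry n => G.value ε A m e.2 :=
    (G.measurable_value hA m).comp measurable_snd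
  by_cases hD : h.pos ∈ G.domain
  · rw [G.value_succ hh hD, G.lintegral_transition_of_mem S₁ S₂ hD hf, roundValue]
    have h2 : G.value ε A m (S₁.move k h) ≤ (⨆ z : ball h.pos ε, G.value ε A m z) :=
      le_iSup (fun z : ball h.pos ε => G.value ε A m z) ⟨_, S₁.move_mem k h⟩
    have h1 : ENNReal.ofReal (G.alpha / 2) * G.value ε A m (S₂.move k h) ≤
        ENNReal.ofReal (G.alpha / 2) * (⨅ z : ball h.pos ε, G.value ε A m z) + η := by
      refine (mul_le_mul_right hS _).trans ?_
      rw [mul_add]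
      gcongr
      exact mul_le_of_le_one_left' G.weight_le_one
    rw [add_right_comm _ _ η]
    gcongr ?_ + _
    rw [add_assoc]
    gcongr
  · rw [G.lintegral_transition_of_notMem S₁ S₂ hD hf]
    refine le_add_right (le_of_eq ?_)
    rw [G.value_of_notMem_domain hh hD]
    exact G.value_of_notMem_domain hh hD m

theorem exists_strategy_value_le (hε : 0 < ε) {A : Set (Space n)} (hA : MeasurableSet A) (N : ℕ)
    {η : ℝ≥0∞} (hη : η ≠ 0) :
    ∃ S₁ : Strategy n ε, ∀ (S₂ : Strategy n ε) (x₀ : Space n),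
      G.value ε A N x₀ ≤ G.law S₁ S₂ x₀ {ω | (ω N).2 ∈ A ∧ (ω N).2 ∉ G.domain} + N * η := by
  choose s hs hs' using fun k => exists_measurable_near_iSup hε (G.value_le_one hε A k) hη
  -- After the move chosen at time `k`, `N - 1 - k` rounds remain. For `k ≥ N` the truncated
  -- difference is `0` and the move is irrelevant.
  let S₁ : Strategy n ε := Strategy.ofPositions (fun k => s (N - 1 - k)) (fun _ => hs _)
    fun k x => (hs' _ x).1
  refine ⟨S₁, fun S₂ x₀ => ?_⟩
  have key : ∀ k ≤ N, G.value ε A N x₀ ≤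
      ∫⁻ ω, G.value ε A (N - k) (ω k).2 ∂G.law S₁ S₂ x₀ + k * η := by
    intro k hk
    induction k with
    | zero =>
      rw [lintegral_congr_ae (g := fun _ => G.value ε A N x₀)]
      · simp
      · filter_upwards [G.ae_law_zero S₁ S₂ x₀] with ω hω
        simp [hω]
    | succ k ih =>
      refine (ih (by lia)).trans ?_
      have h1 := G.lintegral_law_succ S₁ S₂ x₀ k
        (F := fun _ e => G.value ε A (N - (k + 1)) e.2)
        ((G.measurable_value hA _).comp (measurable_snd.comp measurable_snd))
      have h2 : ∫⁻ ω, G.value ε A (N - k) (ω k).2 ∂G.law S₁ S₂ x₀ ≤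
          ∫⁻ ω, (∫⁻ e, G.value ε A (N - (k + 1)) e.2
            ∂G.transition S₁ S₂ k (ω.history k) + η) ∂G.law S₁ S₂ x₀ := by
        refine lintegral_mono fun ω => ?_
        have hm : N - k = N - (k + 1) + 1 := by lia
        have hm' : N - (k + 1) = N - 1 - k := by lia
        rw [hm]
        refine G.le_lintegral_transition_of_near_iSup hA S₁ S₂ (ω.history k) _ ?_
        rw [hm']
        exact (hs' (N - 1 - k) (ω.history k).pos).2
      rw [lintegral_add_right _ measurable_const, ← h1] at h2
      calc _ ≤ _ := add_le_add_left h2 _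
        _ = _ := by
          simp
          ring
  refine (key N le_rfl).trans (add_le_add_left (le_of_eq ?_) _)
  have hm : MeasurableSet {ω : Play n | (ω N).2 ∈ A ∧ (ω N).2 ∉ G.domain} :=
    (measurable_snd.comp (measurable_pi_apply N)) (hA.inter G.isOpen_domain.measurableSet.compl)
  rw [← lintegral_indicator_one hm]
  refine lintegral_congr fun ω => ?_
  by_cases h : (ω N).2 ∈ A ∧ (ω N).2 ∉ G.domain
  · rw [Set.indicator_of_mem (by exact h)]
    simp [value, h]
  · rw [Set.indicator_of_notMem (by exact h)]
    simp [value, h]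

theorem exists_strategy_le_value (hε : 0 < ε) {A : Set (Space n)} (hA : MeasurableSet A) (N : ℕ)
    {η : ℝ≥0∞} (hη : η ≠ 0) :
    ∃ S₂ : Strategy n ε, ∀ (S₁ : Strategy n ε) (x₀ : Space n),
      G.law S₁ S₂ x₀ {ω | (∀ j ≤ N, (ω j).2 ∈ A) ∧ (ω N).2 ∉ G.domain} ≤
        G.value ε A N x₀ + N * η := by
  classical
  choose s hs hs' using fun k => exists_measurable_near_iInf hε (G.value_le_one hε A k) hη
  let S₂ : Strategy n ε := Strategy.ofPositions (fun k => s (N - 1 - k)) (fun _ => hs _)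
    fun k x => (hs' _ x).1
  refine ⟨S₂, fun S₁ x₀ => ?_⟩
  -- The cutoff discards plays that have left `A`. It is strict in `k` because the value itself
  -- vanishes if the position at time `k` is outside `A`.
  have key : ∀ k ≤ N, ∫⁻ ω : Play n, (if ∀ j < k, (ω j).2 ∈ A then
      G.value ε A (N - k) (ω k).2 else 0) ∂G.law S₁ S₂ x₀ ≤ G.value ε A N x₀ + k * η := by
    intro k hk
    induction k with
    | zero =>
      rw [lintegral_congr_ae (g := fun _ => G.value ε A N x₀)]
      · simp
      · filter_upwards [G.ae_law_zero S₁ S₂ x₀] with ω hω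
        simp [hω]
    | succ k ih =>
      have hB : MeasurableSet {h : History n k | ∀ j, (h j).2 ∈ A} := by
        rw [Set.ofPred_forall]
        exact MeasurableSet.iInter fun j =>
          (measurable_snd.comp (measurable_pi_apply j)) hA
      have h1 := G.lintegral_law_succ S₁ S₂ x₀ k
        (F := fun h e => if h ∈ {h : History n k | ∀ j, (h j).2 ∈ A} then
          G.value ε A (N - (k + 1)) e.2 else 0)
        (Measurable.ite (measurable_fst hB)
          ((G.measurable_value hA _).comp (measurable_snd.comp measurable_snd))
          measurable_const)
      have hmem : ∀ ω : Play n, ω.history k ∈ {h : History n k | ∀ j, (h j).2 ∈ A} ↔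
          ∀ j < k + 1, (ω j).2 ∈ A := by
        intro ω
        constructor
        · intro h j hj
          exact h ⟨j, Finset.mem_Iic.2 (by lia)⟩
        · rintro h ⟨j, hj⟩
          exact h j (by rw [Finset.mem_Iic] at hj; lia)
      simp only [hmem] at h1
      rw [h1]
      have h2 : ∀ ω : Play n, ∫⁻ e, (if ∀ j < k + 1, (ω j).2 ∈ A then
            G.value ε A (N - (k + 1)) e.2 else 0) ∂G.transition S₁ S₂ k (ω.history k) ≤
          (if ∀ j < k, (ω j).2 ∈ A then G.value ε A (N - k) (ω k).2 else 0) + η := by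
        intro ω
        split_ifs with ha hb
        · have hm : N - k = N - (k + 1) + 1 := by lia
          have hm' : N - (k + 1) = N - 1 - k := by lia
          rw [hm]
          refine G.lintegral_transition_le_of_near_iInf hA S₁ S₂ (ω.history k)
            (ha k (by lia)) _ ?_
          rw [hm']
          exact (hs' (N - 1 - k) (ω.history k).pos).2
        · exact absurd (fun j hj => ha j (by lia)) hb
        all_goals simp
      calc _ ≤ _ := lintegral_mono h2
        _ = _ := lintegral_add_right _ measurable_const
        _ ≤ G.value ε A N x₀ + k * η + η := by
          gcongr
          · exact ih (by lia)
          · simp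
        _ = _ := by
          push_cast
          ring
  refine le_trans ?_ (key N le_rfl)
  rw [← lintegral_indicator_one]
  · refine lintegral_mono fun ω => ?_
    by_cases hω : (∀ j ≤ N, (ω j).2 ∈ A) ∧ (ω N).2 ∉ G.domain
    · rw [Set.indicator_of_mem (by exact hω), if_pos fun j hj => hω.1 j hj.le,
        G.value_of_notMem_domain (hω.1 N le_rfl) hω.2]
      rfl
    · rw [Set.indicator_of_notMem (by exact hω)]
      exact zero_le
  · have h1 : MeasurableSet {ω : Play n | ∀ j ≤ N, (ω j).2 ∈ A} := by
      rw [Set.ofPred_forall]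
      refine MeasurableSet.iInter fun j => ?_
      rw [Set.ofPred_forall]
      exact MeasurableSet.iInter fun _ => (measurable_snd.comp (measurable_pi_apply j)) hA
    exact h1.inter
      ((measurable_snd.comp (measurable_pi_apply N)) G.isOpen_domain.measurableSet.compl)

/-! ### The noise ends the game -/

/-- A bounded function whose expected value at least doubles in each round that starts in the
domain, whatever the moves of the players. -/
theorem exists_noise_drift (hn : 1 ≤ n) (hε : 0 < ε) :
    ∃ (g : Space n → ℝ≥0∞) (C : ℝ≥0∞), Measurable g ∧ C ≠ ∞ ∧ (∀ x, g x ≤ C) ∧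
      ∀ x ∈ G.domain, 1 ≤ g x ∧
        2 * g x ≤ ENNReal.ofReal G.beta * ∫⁻ z, g z ∂volume[|ball x ε] := by
  obtain ⟨R, hR⟩ := G.isBounded_domain.exists_norm_le
  let i : Fin n := ⟨0, hn⟩
  -- The ball of radius `ε / 4` about `x + v` lies in `ball x ε`, and on it the coordinate `i`
  -- exceeds `x i` by more than `ε / 2`. The noise hits it with the fixed probability `q`.
  let v : Space n := EuclideanSpace.single i (3 * ε / 4)
  have hv : ‖v‖ = 3 * ε / 4 := by
    rw [PiLp.norm_single, Real.norm_of_nonneg (by positivity)]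
  set q : ℝ≥0∞ := (volume (ball (0 : Space n) ε))⁻¹ * volume (ball (0 : Space n) (ε / 4)) with hq
  have hq0 : q ≠ 0 := mul_ne_zero (ENNReal.inv_ne_zero.2 measure_ball_lt_top.ne)
    (measure_ball_pos _ _ (by positivity)).ne'
  have hqt : q ≠ ∞ := ENNReal.mul_ne_top
    (ENNReal.inv_ne_top.2 (measure_ball_pos _ _ hε).ne') measure_ball_lt_top.ne
  set c : ℝ := G.beta * q.toReal with hc
  have hc0 : 0 < c := mul_pos G.beta_pos (ENNReal.toReal_pos hq0 hqt)
  have hcq : ENNReal.ofReal G.beta * q = ENNReal.ofReal c := by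
    rw [hc, ENNReal.ofReal_mul G.beta_pos.le, ENNReal.ofReal_toReal hqt]
  -- Chosen so that `s * (ε / 2) = 2 / c`; then `c * exp (2 / c) ≥ c * (2 / c) = 2`.
  let s : ℝ := 4 / (ε * c)
  have hs : 0 < s := by positivity
  have hexp : 2 ≤ c * Real.exp (s * (ε / 2)) := by
    have h1 : s * (ε / 2) = 2 / c := by
      simp only [s]
      field_simp
      norm_num
    have h2 := Real.add_one_le_exp (2 / c)
    calc (2 : ℝ) = c * (2 / c) := by field_simp
      _ ≤ _ := by
        rw [h1]
        gcongr
        linarith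
  -- The shift by `R` gives `g ≥ 1` on the domain. The cap at `R + ε` bounds `g` without spoiling
  -- the growth, since `x i + ε / 2 ≤ R + ε` there.
  let g : Space n → ℝ≥0∞ := fun x => ENNReal.ofReal (Real.exp (s * (min (x i) (R + ε) + R)))
  have hg : Measurable g := by fun_prop
  refine ⟨g, ENNReal.ofReal (Real.exp (s * (R + ε + R))), hg, ENNReal.ofReal_ne_top,
    fun x => ?_, fun x hx => ?_⟩
  · refine ENNReal.ofReal_le_ofReal (Real.exp_le_exp.2 ?_)
    gcongr
    exact min_le_right _ _
  · have hxi : |x i| ≤ R := (PiLp.norm_apply_le x i).trans (hR x hx)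
    rw [abs_le] at hxi
    have hgx : g x = ENNReal.ofReal (Real.exp (s * (x i + R))) := by
      simp only [g]
      rw [min_eq_left (by linarith)]
    rw [hgx]
    constructor
    · rw [ENNReal.one_le_ofReal, Real.one_le_exp_iff]
      exact mul_nonneg hs.le (by linarith)
    · have hsub : ball (x + v) (ε / 4) ⊆
          {z | ENNReal.ofReal (Real.exp (s * (x i + ε / 2 + R))) ≤ g z} := by
        intro z hz
        refine ENNReal.ofReal_le_ofReal (Real.exp_le_exp.2 ?_)
        have h1 : |(z - (x + v)) i| < ε / 4 :=
          (PiLp.norm_apply_le (z - (x + v)) i).trans_lt (by rwa [mem_ball_iff_norm] at hz)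
        have h2 : (z - (x + v)) i = z i - (x i + 3 * ε / 4) := by simp [v]
        rw [h2, abs_lt] at h1
        gcongr
        exact le_min (by linarith) (by linarith)
      calc _ = ENNReal.ofReal (2 * Real.exp (s * (x i + R))) := by
            rw [ENNReal.ofReal_mul (by norm_num), ENNReal.ofReal_ofNat]
        _ ≤ ENNReal.ofReal (c * Real.exp (s * (x i + ε / 2 + R))) := by
            refine ENNReal.ofReal_le_ofReal ?_
            have h3 : s * (x i + ε / 2 + R) = s * (ε / 2) + s * (x i + R) := by ring
            rw [h3, Real.exp_add, ← mul_assoc]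
            gcongr
        _ = ENNReal.ofReal G.beta * (ENNReal.ofReal (Real.exp (s * (x i + ε / 2 + R))) * q) := by
            rw [ENNReal.ofReal_mul hc0.le, ← hcq]
            ring
        _ ≤ _ := by
            gcongr
            refine le_trans ?_ (mul_meas_ge_le_lintegral hg
              (ENNReal.ofReal (Real.exp (s * (x i + ε / 2 + R)))))
            gcongr
            rw [hq, ← uniform_ball_add x v (ρ := ε / 4) (ε := ε) (by rw [hv]; linarith)]
            exact measure_mono hsub

/-- In the domain `2 * g ≥ g + 1`, and outside the position is frozen. So the mean of `g` grows in
each round by at least the probability that the position is still in the domain. -/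
theorem lintegral_add_law_domain_le (S₁ S₂ : Strategy n ε) (x₀ : Space n) {g : Space n → ℝ≥0∞}
    (hg : Measurable g) (h : ∀ x ∈ G.domain, 1 ≤ g x ∧
      2 * g x ≤ ENNReal.ofReal G.beta * ∫⁻ z, g z ∂volume[|ball x ε]) (k : ℕ) :
    ∫⁻ ω, g (ω k).2 ∂G.law S₁ S₂ x₀ + G.law S₁ S₂ x₀ {ω | (ω k).2 ∈ G.domain} ≤
      ∫⁻ ω, g (ω (k + 1)).2 ∂G.law S₁ S₂ x₀ := by
  have hm : MeasurableSet {ω : Play n | (ω k).2 ∈ G.domain} :=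
    (measurable_snd.comp (measurable_pi_apply k)) G.isOpen_domain.measurableSet
  have h1 := G.lintegral_law_succ S₁ S₂ x₀ k (F := fun _ e => g e.2)
    (hg.comp (measurable_snd.comp measurable_snd))
  have hgk : Measurable fun ω : Play n => g (ω k).2 :=
    hg.comp (measurable_snd.comp (measurable_pi_apply k))
  rw [h1, ← lintegral_indicator_one hm, ← lintegral_add_left hgk]
  have hg2 : Measurable fun e : Entry n => g e.2 := hg.comp measurable_snd
  refine lintegral_mono fun ω => ?_
  by_cases hω : (ω k).2 ∈ G.domain
  · rw [Set.indicator_of_mem (by exact hω), G.lintegral_transition_of_mem S₁ S₂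
      (h := ω.history k) hω hg2]
    refine le_add_left (le_trans ?_ (h _ hω).2)
    rw [two_mul]
    exact add_le_add_right (h _ hω).1 _
  · rw [Set.indicator_of_notMem (by exact hω), G.lintegral_transition_of_notMem S₁ S₂
      (h := ω.history k) hω hg2, add_zero]
    rfl

theorem antitone_law_domain (S₁ S₂ : Strategy n ε) (x₀ : Space n) :
    Antitone fun k => G.law S₁ S₂ x₀ {ω | (ω k).2 ∈ G.domain} := by
  refine antitone_nat_of_succ_le fun k => measure_mono_ae ?_
  filter_upwards [G.ae_law_succ S₁ S₂ x₀] with ω hω h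
  rcases (hω k).2 with h' | h'
  · exact h'
  · change (ω (k + 1)).2 ∈ G.domain at h
    rwa [h'] at h

/-- The game ends almost surely, uniformly in the strategies and the starting point. -/
theorem exists_forall_law_domain_le (hn : 1 ≤ n) (hε : 0 < ε) {η : ℝ≥0∞} (hη : η ≠ 0) :
    ∃ N : ℕ, ∀ (S₁ S₂ : Strategy n ε) (x₀ : Space n),
      G.law S₁ S₂ x₀ {ω | (ω N).2 ∈ G.domain} ≤ η := by
  obtain ⟨g, C, hg, hC, hgC, h⟩ := G.exists_noise_drift hn hε
  obtain ⟨N, hN⟩ := ENNReal.exists_nat_mul_gt hη hC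
  refine ⟨N, fun S₁ S₂ x₀ => ?_⟩
  -- The probability of being in the domain decreases in time, so each of the first `N` rounds adds
  -- at least its value at time `N`. The total is bounded by `C`.
  have key : ∀ k ≤ N, k * G.law S₁ S₂ x₀ {ω | (ω N).2 ∈ G.domain} ≤
      ∫⁻ ω, g (ω k).2 ∂G.law S₁ S₂ x₀ := by
    intro k hk
    induction k with
    | zero => simp
    | succ k ih =>
      refine le_trans ?_ (G.lintegral_add_law_domain_le S₁ S₂ x₀ hg h k)
      rw [Nat.cast_succ, add_mul, one_mul]
      exact add_le_add (ih (by lia)) (G.antitone_law_domain S₁ S₂ x₀ (by lia))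
  have hle : N * G.law S₁ S₂ x₀ {ω | (ω N).2 ∈ G.domain} ≤ C := by
    refine (key N le_rfl).trans ((lintegral_mono fun ω => hgC _).trans ?_)
    simp
  by_contra! hlt
  exact absurd (hN.trans_le (mul_le_mul_right hlt.le _)) (not_lt.2 hle)

/-! ### From events of the game to values and back -/

/-- The segment from `x` to `z` is connected, so it meets the frontier. Hence a step shorter than
`ε` out of the domain ends in the strip. -/
theorem infDist_frontier_le {x z : Space n} (hx : x ∈ G.domain) (hz : z ∉ G.domain) :
    infDist z (frontier G.domain) ≤ dist z x := by
  obtain ⟨w, hw, hw'⟩ : (segment ℝ x z ∩ frontier G.domain).Nonempty := by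
    by_contra hne
    have hcl : ∀ w ∈ segment ℝ x z, w ∉ G.domain → w ∈ (closure G.domain)ᶜ := by
      intro w hw hwD hwc
      refine hne ⟨w, hw, ?_⟩
      rw [G.isOpen_domain.frontier_eq]
      exact ⟨hwc, hwD⟩
    obtain ⟨w, -, hw1, hw2⟩ := (convex_segment x z).isPreconnected G.domain (closure G.domain)ᶜ
      G.isOpen_domain isClosed_closure.isOpen_compl
      (fun w hw => or_iff_not_imp_left.2 (hcl w hw)) ⟨x, left_mem_segment ℝ x z, hx⟩
      ⟨z, right_mem_segment ℝ x z, hcl z (right_mem_segment ℝ x z) hz⟩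
    exact hw2 (subset_closure hw1)
  refine (infDist_le_dist_of_mem hw').trans ?_
  have := mem_segment_iff_wbtw.1 hw
  have h1 := this.dist_add_dist
  rw [dist_comm z w, dist_comm z x]
  linarith [dist_nonneg (x := x) (y := w)]

/-- The first position outside the domain is in the strip, and it is frozen from then on, so it
equals the position at time `N`. -/
theorem ae_endsIn (S₁ S₂ : Strategy n ε) {x₀ : Space n} (hx₀ : x₀ ∈ G.domain)
    (A : Set (Space n)) (N : ℕ) :
    ∀ᵐ ω ∂G.law S₁ S₂ x₀, (ω N).2 ∈ A ∧ (ω N).2 ∉ G.domain →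
      ω ∈ G.endsIn ε (A ∩ G.domainᶜ) := by
  classical
  filter_upwards [G.ae_law_zero S₁ S₂ x₀, G.ae_law_succ S₁ S₂ x₀] with ω h0 hs ⟨hA, hD⟩
  have hex : ∃ k, (ω k).2 ∉ G.domain := ⟨N, hD⟩
  have hstay : ∀ m, (ω (Nat.find hex + m)).2 = (ω (Nat.find hex)).2 := by
    intro m
    induction m with
    | zero => rfl
    | succ m ih =>
      rcases (hs (Nat.find hex + m)).2 with h | h
      · rw [ih] at h
        exact absurd h (Nat.find_spec hex)
      · exact h.trans ih
  have hN : (ω (Nat.find hex)).2 = (ω N).2 := by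
    obtain ⟨m, hm⟩ := Nat.exists_eq_add_of_le (Nat.find_min' hex hD)
    rw [hm, hstay]
  refine ⟨Nat.find hex, ⟨⟨Nat.find_spec hex, ?_⟩, fun j hj => Nat.find_min' hex hj.1⟩, ?_⟩
  · obtain ⟨m, hm⟩ : ∃ m, Nat.find hex = m + 1 := by
      refine Nat.exists_eq_succ_of_ne_zero fun h => ?_
      have := Nat.find_spec hex
      rw [h, h0] at this
      exact this hx₀
    have hmD : (ω m).2 ∈ G.domain := not_not.1 (Nat.find_min hex (hm ▸ Nat.lt_succ_self m))
    refine (G.infDist_frontier_le hmD (Nat.find_spec hex)).trans ?_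
    rw [hm]
    exact (hs m).1.le
  · rw [hN]
    exact ⟨hA, hD⟩

theorem ae_of_endsBeforeExiting (S₁ S₂ : Strategy n ε) (x₀ : Space n)
    (A : Set (Space n)) (N : ℕ) :
    ∀ᵐ ω ∂G.law S₁ S₂ x₀, ω ∈ G.endsBeforeExiting ε A → (ω N).2 ∉ G.domain →
      ∀ j ≤ N, (ω j).2 ∈ A := by
  filter_upwards [G.ae_law_succ S₁ S₂ x₀] with ω hs ⟨k, hk, hA⟩ hN
  have hstay : ∀ m, (ω (k + m)).2 = (ω k).2 := by
    intro m
    induction m with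
    | zero => rfl
    | succ m ih =>
      rcases (hs (k + m)).2 with h | h
      · rw [ih] at h
        exact absurd h hk.1.1
      · exact h.trans ih
  intro j _
  rcases le_total j k with h | h
  · exact hA j h
  · obtain ⟨m, rfl⟩ := Nat.exists_eq_add_of_le h
    rw [hstay]
    exact hA k le_rfl

/-- If Player 1 can win with probability `θ` before exiting `A`, then also almost with probability
`θ` within a number of rounds that does not depend on the starting point. -/
theorem exists_le_value (hn : 1 ≤ n) (hε : 0 < ε) {A : Set (Space n)} (hA : MeasurableSet A)
    (θ : ℝ≥0∞) {η : ℝ≥0∞} (hη : η ≠ 0) :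
    ∃ N : ℕ, ∀ x₀, (∃ S₁ : Strategy n ε, ∀ S₂ : Strategy n ε,
      θ ≤ G.law S₁ S₂ x₀ (G.endsBeforeExiting ε A)) → θ ≤ G.value ε A N x₀ + η := by
  obtain ⟨N, hN⟩ := G.exists_forall_law_domain_le hn hε (ENNReal.half_pos hη).ne'
  have hη' : η / 2 / (N + 1) ≠ 0 :=
    ENNReal.div_ne_zero.2 ⟨(ENNReal.half_pos hη).ne', by finiteness⟩
  -- This one opponent is almost optimal against every `S₁` from every starting point. Half of `η`
  -- pays for its errors, the other half for games longer than `N` rounds.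
  obtain ⟨S₂, hS₂⟩ := G.exists_strategy_le_value hε hA N hη'
  refine ⟨N, fun x₀ ⟨S₁, hS₁⟩ => (hS₁ S₂).trans ?_⟩
  have hNη : (N : ℝ≥0∞) * (η / 2 / (N + 1)) ≤ η / 2 := by
    calc _ ≤ (N + 1 : ℝ≥0∞) * (η / 2 / (N + 1)) := by gcongr; exact le_self_add
      _ = η / 2 := ENNReal.mul_div_cancel (by simp) (by finiteness)
  have hsub : G.law S₁ S₂ x₀ (G.endsBeforeExiting ε A) ≤
      G.law S₁ S₂ x₀ ({ω | (∀ j ≤ N, (ω j).2 ∈ A) ∧ (ω N).2 ∉ G.domain} ∪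
        {ω | (ω N).2 ∈ G.domain}) := by
    refine measure_mono_ae ?_
    filter_upwards [G.ae_of_endsBeforeExiting S₁ S₂ x₀ A N] with ω hω h
    by_cases hD : (ω N).2 ∈ G.domain
    · exact Or.inr hD
    · exact Or.inl ⟨hω h hD, hD⟩
  calc _ ≤ _ := hsub
    _ ≤ _ := measure_union_le _ _
    _ ≤ (G.value ε A N x₀ + η / 2) + η / 2 :=
      add_le_add ((hS₂ S₁ x₀).trans (add_le_add_right hNη _)) (hN S₁ S₂ x₀)
    _ = _ := by rw [add_assoc, ENNReal.add_halves]

theorem exists_strategy_endsIn (hε : 0 < ε) {A : Set (Space n)} (hA : MeasurableSet A) (N : ℕ)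
    {η : ℝ≥0∞} (hη : η ≠ 0) :
    ∃ S₁ : Strategy n ε, ∀ S₂ : Strategy n ε, ∀ x₀ ∈ G.domain,
      G.value ε A N x₀ ≤ G.law S₁ S₂ x₀ (G.endsIn ε (A ∩ G.domainᶜ)) + η := by
  have hη' : η / (N + 1) ≠ 0 := ENNReal.div_ne_zero.2 ⟨hη, by finiteness⟩
  have hNη : (N : ℝ≥0∞) * (η / (N + 1)) ≤ η := by
    calc _ ≤ (N + 1 : ℝ≥0∞) * (η / (N + 1)) := by gcongr; exact le_self_add
      _ = η := ENNReal.mul_div_cancel (by simp) (by finiteness)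
  obtain ⟨S₁, hS₁⟩ := G.exists_strategy_value_le hε hA N hη'
  refine ⟨S₁, fun S₂ x₀ hx₀ => (hS₁ S₂ x₀).trans (add_le_add (measure_mono_ae ?_) hNη)⟩
  filter_upwards [G.ae_endsIn S₁ S₂ hx₀ A N] with ω hω h using hω h

/-! ### Repeated attempts and conclusion -/

/-- Trying `m` times, with success probability at least `θ` each time. -/
theorem exists_le_value_of_attempts (y : Space n) {θ : ℝ≥0∞} (hθ : θ ≤ 1)
    (h : ∀ δ : ℝ, 0 < δ → ∃ ε₀ : ℝ, 0 < ε₀ ∧ ∃ δ₀ : ℝ, 0 < δ₀ ∧ ∀ ε : ℝ, 0 < ε → ε < ε₀ →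
      ∃ N : ℕ, ∀ x ∈ ball y δ₀ ∩ G.domain, θ ≤ G.value ε (ball y δ) N x)
    (m : ℕ) (δ : ℝ) (hδ : 0 < δ) :
    ∃ ε₀ : ℝ, 0 < ε₀ ∧ ∃ δ₀ : ℝ, 0 < δ₀ ∧ ∀ ε : ℝ, 0 < ε → ε < ε₀ →
      ∃ N : ℕ, ∀ x ∈ ball y δ₀ ∩ G.domain, 1 - (1 - θ) ^ m ≤ G.value ε (ball y δ) N x := by
  induction m with
  | zero => exact ⟨1, one_pos, 1, one_pos, fun ε _ _ => ⟨0, fun x _ => by simp⟩⟩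
  | succ m ih =>
    obtain ⟨ε₁, hε₁, δ₁, hδ₁, h₁⟩ := ih
    -- The new attempt comes first, in `ball y (ρ / 2)`. As `ε < ρ / 2`, a failing exit stays in
    -- `ball y ρ`, which lies in `ball y δ` and in the ball where the other `m` attempts are
    -- available.
    set ρ := min δ₁ δ with hρ
    have hρ0 : 0 < ρ := lt_min hδ₁ hδ
    obtain ⟨ε₂, hε₂, δ₂, hδ₂, h₂⟩ := h (ρ / 2) (by positivity)
    refine ⟨min (min ε₁ ε₂) (ρ / 2), by positivity, min δ₂ (ρ / 2), by positivity, fun ε hε hε' => ?_⟩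
    rw [lt_min_iff, lt_min_iff] at hε'
    obtain ⟨M, hM⟩ := h₁ ε hε hε'.1.1
    obtain ⟨N, hN⟩ := h₂ ε hε hε'.1.2
    refine ⟨M + N, fun x hx => ?_⟩
    have hx1 := ball_subset_ball (min_le_left _ _) hx.1
    have hx2 := ball_subset_ball (min_le_right _ _) hx.1
    have hq : (1 - θ) ^ m ≤ 1 := pow_le_one₀ zero_le tsub_le_self
    have key := G.add_mul_value_le hε y (r := ρ / 2) (R := δ) (c := 1 - (1 - θ) ^ m)
      (by linarith [min_le_right δ₁ δ]) tsub_le_self (M := M)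
      (fun z hz => hM z ⟨ball_subset_ball (by linarith [min_le_left δ₁ δ]) hz.1, hz.2⟩) N
      (ball_subset_ball (by linarith) hx2)
    refine le_trans ?_ key
    rw [ENNReal.sub_sub_cancel ENNReal.one_ne_top hq, tsub_le_iff_right]
    calc (1 : ℝ≥0∞) = 1 - (1 - θ) ^ m + (1 - θ) ^ m * (θ + (1 - θ)) := by
          rw [add_tsub_cancel_of_le hθ, mul_one, tsub_add_cancel_of_le hq]
      _ = 1 - (1 - θ) ^ m + (1 - θ) ^ m * θ + (1 - θ) ^ (m + 1) := by ring
      _ ≤ _ := by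
          gcongr
          exact hN x ⟨hx1, hx.2⟩

end TugOfWar

theorem lemma3p3 {n : ℕ} (hn : 1 ≤ n) (G : TugOfWar n) (y : Space n)
    (hy : y ∈ frontier G.domain)
    (h : ∃ θ : ℝ, 0 < θ ∧ ∀ δ : ℝ, 0 < δ → ∃ ε₀ : ℝ, 0 < ε₀ ∧ ∃ δ₀ : ℝ, 0 < δ₀ ∧
      ∀ ε : ℝ, 0 < ε → ε < ε₀ → ∀ x₀ ∈ Metric.ball y δ₀ ∩ G.domain,
        ∃ S₁ : Strategy n ε, ∀ S₂ : Strategy n ε,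
          θ ≤ (G.law S₁ S₂ x₀).real (G.endsBeforeExiting ε (Metric.ball y δ))) :
    G.GameRegular y := by
  obtain ⟨θ, hθ, h⟩ := h
  -- Half of the success probability is given up for the passage to a finite horizon.
  set t : ℝ≥0∞ := min (ENNReal.ofReal θ) 1 / 2 with ht
  have ht0 : t ≠ 0 :=
    (ENNReal.half_pos (lt_min (ENNReal.ofReal_pos.2 hθ) one_pos).ne').ne'
  have ht1 : t ≤ 1 := ENNReal.half_le_self.trans (min_le_right _ _)
  have hval : ∀ δ : ℝ, 0 < δ → ∃ ε₀ : ℝ, 0 < ε₀ ∧ ∃ δ₀ : ℝ, 0 < δ₀ ∧ ∀ ε : ℝ, 0 < ε → ε < ε₀ →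
      ∃ N : ℕ, ∀ x ∈ ball y δ₀ ∩ G.domain, t ≤ G.value ε (ball y δ) N x := by
    intro δ hδ
    obtain ⟨ε₀, hε₀, δ₀, hδ₀, h⟩ := h δ hδ
    refine ⟨ε₀, hε₀, δ₀, hδ₀, fun ε hε hε' => ?_⟩
    obtain ⟨N, hN⟩ := G.exists_le_value hn hε measurableSet_ball
      (A := ball y δ) (min (ENNReal.ofReal θ) 1) ht0
    refine ⟨N, fun x hx => ?_⟩
    obtain ⟨S₁, hS₁⟩ := h ε hε hε' x hx
    have h1 := hN x ⟨S₁, fun S₂ => (min_le_left _ _).trans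
      (ENNReal.ofReal_le_of_le_toReal (hS₁ S₂))⟩
    rw [← ENNReal.add_halves (min (ENNReal.ofReal θ) 1)] at h1
    exact (ENNReal.add_le_add_iff_right (ne_top_of_le_ne_top ENNReal.one_ne_top ht1)).1 h1
  intro δ hδ η hη
  -- One half of `η` covers the failure of all `m` attempts, the other the suboptimality of the
  -- strategy realizing the value.
  have hη2 : ENNReal.ofReal (η / 2) ≠ 0 := (ENNReal.ofReal_pos.2 (by positivity)).ne'
  obtain ⟨m, hm⟩ := ((ENNReal.tendsto_pow_atTop_nhds_zero_of_lt_one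
    (ENNReal.sub_lt_self ENNReal.one_ne_top one_ne_zero ht0)).eventually_lt_const
    hη2.bot_lt).exists
  obtain ⟨ε₀, hε₀, δ₀, hδ₀, h⟩ := G.exists_le_value_of_attempts y ht1 hval m δ hδ
  refine ⟨δ₀, hδ₀, ε₀, hε₀, fun ε hε hε' x₀ hx₀ => ?_⟩
  obtain ⟨N, hN⟩ := h ε hε hε'
  obtain ⟨S₁, hS₁⟩ := G.exists_strategy_endsIn hε (measurableSet_ball (x := y) (ε := δ)) N hη2
  refine ⟨S₁, fun S₂ => ?_⟩
  have h1 : 1 ≤ G.law S₁ S₂ x₀ (G.endsIn ε (ball y δ ∩ G.domainᶜ)) + ENNReal.ofReal η := by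
    have h2 := tsub_le_iff_right.1 ((hN x₀ hx₀).trans (hS₁ S₂ x₀ hx₀.2))
    refine h2.trans ?_
    rw [add_assoc]
    gcongr
    refine (add_le_add_right hm.le _).trans (le_of_eq ?_)
    rw [← ENNReal.ofReal_add (by positivity) (by positivity), add_halves]
  have h3 := ENNReal.toReal_mono (by finiteness) h1
  rw [ENNReal.toReal_add (by finiteness) (by finiteness), ENNReal.toReal_ofReal hη.le,
    ENNReal.toReal_one] at h3
  rw [measureReal_def]
  linarith
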